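/- Let $n\ge 3$, and let $x_0,\dots,x_{n-1}$ be the standard coordinates on $\mathbb{R}^n$ with coordinate vector fields $\partial_0,\dots,\partial_{n-1}$. For $c>0$ let $g^c_n$ be the Lorentzian metric on $\mathbb{R}^n$ for which the frame $$e_0=\tfrac1c\,\partial_0,\qquad e_1=\partial_1-x_2\,\partial_0,\qquad e_2=\partial_2,\qquad e_i=\partial_i\ \ (3\le i\le n-1)$$ is orthonormal with $e_0$ timelike, i.e. $g^c_n(e_i,e_j)=\varepsilon_i\delta_{ij}$ with $\varepsilon_0=-1$ and $\varepsilon_i=1$ for $i\ge1$. (Thus $g^c_n$ is the product of $g^c_3$ on $\mathbb{R}^3$ with the euclidean metric on $\mathbb{R}^{n-3}$.) A tangent vector $v$ is called $g$-timelike if $g(v,v)<0$ and $g$-spacelike if $g(v,v)>0$. A $g^c_n$-space foliation of an open set $U$ is a smooth codimension-one foliation of $U$ all of whose nonzero tangent vectors are $g^c_n$-spacelike. For $\Lambda\in\mathbb{R}$, let $T=\mathrm{Ric}_g-\frac12\,\mathrm{scal}_g\,g+\Lambda g$. The metric $g$ satisfies the dominant energy condition with cosmological constant $\Lambda$ if for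 every $g$-timelike tangent vector $v$ (at any point) one has $T(v,v)\ge0$ and the vector $-\sharp(T(v,\cdot))$ is not $g$-spacelike, where $\sharp$ is the isomorphism from covectors to vectors induced by $g$. **Theorem.** Let $n\ge3$. To every $\Lambda\in\mathbb{R}$ and every nonempty open set $U\subseteq\mathbb{R}^n$, there exists a number $c_0>0$ such that for all $c\ge c_0$, the metric $g^c_n$ has the following properties: 1. $U$ does not admit a smooth codimension-one foliation none of whose tangent vectors is $g^c_n$-timelike; in particular, $U$ does not admit a $g^c_n$-space foliation. 2. $g^c_n$ satisfies, on all of $\mathbb{R}^n$, the dominant energy condition with cosmological constant $\Lambda$. -/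

import Mathlib

open scoped ContDiff Topology

noncomputable section

/-! Throughout, the manifold `ℝⁿ` is `Fin n → ℝ`: only its topology and its smooth structure are
used, and its tangent spaces are identified with `Fin n → ℝ` through the standard coordinates
`x₀, …, x_{n-1}`. A field of bilinear forms on `ℝⁿ` assigns a bilinear form to every point. -/

/-- A field of bilinear forms on `ℝⁿ` (the type of metric tensors, Ricci tensors, …). -/
abbrev BilinField (n : ℕ) : Type :=
  (Fin n → ℝ) → LinearMap.BilinForm ℝ (Fin n → ℝ)

namespace BilinField

variable {n : ℕ}

/-- The coordinate vector `∂ᵢ`. -/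
def coordVec (i : Fin n) : Fin n → ℝ := Pi.single i 1

/-- The partial derivative `∂ᵢ f`. -/
def partialDeriv (i : Fin n) (f : (Fin n → ℝ) → ℝ) (x : Fin n → ℝ) : ℝ :=
  fderiv ℝ f x (coordVec i)

/-- The matrix of components `gᵢⱼ(x) = g_x(∂ᵢ, ∂ⱼ)`. -/
def components (g : BilinField n) (x : Fin n → ℝ) : Matrix (Fin n) (Fin n) ℝ :=
  Matrix.of fun i j => g x (coordVec i) (coordVec j)

/-- The components `gⁱʲ(x)` of the inverse metric. -/
def invComponents (g : BilinField n) (x : Fin n → ℝ) : Matrix (Fin n) (Fin n) ℝ :=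
  (components g x)⁻¹

/-- The Christoffel symbols of the Levi-Civita connection of `g`:
`Γᵏᵢⱼ = ½ ∑ₗ gᵏˡ (∂ᵢ gⱼₗ + ∂ⱼ gᵢₗ - ∂ₗ gᵢⱼ)`, i.e. `∇_{∂ᵢ} ∂ⱼ = ∑ₖ Γᵏᵢⱼ ∂ₖ`. -/
def christoffel (g : BilinField n) (k i j : Fin n) (x : Fin n → ℝ) : ℝ :=
  (1 / 2 : ℝ) * ∑ l, invComponents g x k l *
    (partialDeriv i (fun y => components g y j l) x
      + partialDeriv j (fun y => components g y i l) x
      - partialDeriv l (fun y => components g y i j) x)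

/-- The components of the Riemann curvature tensor:
`(∇_{∂ᵢ} ∇_{∂ⱼ} - ∇_{∂ⱼ} ∇_{∂ᵢ}) ∂ₖ = ∑ₗ (riemann g l k i j) ∂ₗ`. -/
def riemann (g : BilinField n) (l k i j : Fin n) (x : Fin n → ℝ) : ℝ :=
  partialDeriv i (christoffel g l j k) x - partialDeriv j (christoffel g l i k) x
    + ∑ m, (christoffel g l i m x * christoffel g m j k x
      - christoffel g l j m x * christoffel g m i k x)

/-- The Ricci tensor `Ric(u, v) = trace (w ↦ R(w, u) v)` (positive on round spheres). -/
def ricci (g : BilinField n) : BilinField n := fun x =>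
  Matrix.toBilin' (Matrix.of fun j k => ∑ i, riemann g i k i j x)

/-- The scalar curvature `∑ᵢⱼ gⁱʲ Ricᵢⱼ`. -/
def scal (g : BilinField n) (x : Fin n → ℝ) : ℝ :=
  ∑ i, ∑ j, invComponents g x i j * components (ricci g) x i j

/-- The energy-momentum tensor `T = Ric - ½ scal g + Λ g`. -/
def energyMomentum (g : BilinField n) (Λ : ℝ) : BilinField n := fun x =>
  ricci g x - ((1 / 2 : ℝ) * scal g x) • g x + Λ • g x

/-- The isomorphism `♯ : T*ₓℝⁿ → Tₓℝⁿ` induced by the metric `g`: `(♯ α)ⁱ = ∑ⱼ gⁱʲ αⱼ`. -/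
def sharp (g : BilinField n) (x : Fin n → ℝ) (α : (Fin n → ℝ) →ₗ[ℝ] ℝ) : Fin n → ℝ :=
  (invComponents g x).mulVec fun j => α (coordVec j)

/-- The tangent vector `v` at `x` is `g`-timelike. -/
def IsTimelike (g : BilinField n) (x v : Fin n → ℝ) : Prop := g x v v < 0

/-- The tangent vector `v` at `x` is `g`-spacelike (in the convention in which the zero vector is
not spacelike). -/
def IsSpacelike (g : BilinField n) (x v : Fin n → ℝ) : Prop := 0 < g x v v

/-- The weak energy condition: `T(v, v) ≥ 0` for every timelike vector `v`. -/
def WeakEnergyCondition (g : BilinField n) (Λ : ℝ) : Prop :=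
  ∀ x v, IsTimelike g x v → 0 ≤ energyMomentum g Λ x v v

/-- The semi-dominant energy condition: `-♯(T(v, ·))` is not spacelike for every timelike `v`. -/
def SemiDominantEnergyCondition (g : BilinField n) (Λ : ℝ) : Prop :=
  ∀ x v, IsTimelike g x v → ¬ IsSpacelike g x (-(sharp g x (energyMomentum g Λ x v)))

/-- The dominant energy condition with respect to the cosmological constant `Λ`. -/
def DominantEnergyCondition (g : BilinField n) (Λ : ℝ) : Prop :=
  WeakEnergyCondition g Λ ∧ SemiDominantEnergyCondition g Λ

end BilinField

/-- A smooth codimension-`q` foliation of the open set `U ⊆ ℝⁿ`, given by a foliated atlas: a set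
of smooth charts `ℝⁿ ⊇ source → target ⊆ ℝ^{n-q} × ℝ^q` covering `U`, all of whose transition maps
are locally of the form `(a, b) ↦ (h₁(a, b), h₂(b))`. The plaques (the connected components of the
level sets of the second component of a chart) are open pieces of the leaves. -/
structure Foliation (n q : ℕ) (U : Set (Fin n → ℝ)) where
  /-- the foliated charts -/
  atlas : Set (OpenPartialHomeomorph (Fin n → ℝ) ((Fin (n - q) → ℝ) × (Fin q → ℝ)))
  source_subset : ∀ φ ∈ atlas, φ.source ⊆ U
  exists_chart : ∀ x ∈ U, ∃ φ ∈ atlas, x ∈ φ.source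
  smooth : ∀ φ ∈ atlas, ContDiffOn ℝ ∞ φ φ.source
  smooth_symm : ∀ φ ∈ atlas, ContDiffOn ℝ ∞ φ.symm φ.target
  compatible : ∀ φ ∈ atlas, ∀ ψ ∈ atlas, ∀ z ∈ (φ.symm.trans ψ).source,
    ∃ h : (Fin q → ℝ) → (Fin q → ℝ), ∀ᶠ w in 𝓝 z, (ψ (φ.symm w)).2 = h w.2

namespace Foliation

variable {n q : ℕ} {U : Set (Fin n → ℝ)}

/-- The vector `v` at `x` is tangent to the foliation, i.e. tangent to the leaf through `x`: in a
foliated chart `φ` around `x`, the leaf is locally `{y | (φ y).2 = (φ x).2}`, so that its tangent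
space is the set of all `v` whose image under `Dφ(x)` has vanishing `ℝ^q`-component. -/
def IsTangent (F : Foliation n q U) (x v : Fin n → ℝ) : Prop :=
  ∃ φ ∈ F.atlas, x ∈ φ.source ∧ (fderiv ℝ φ x v).2 = 0

/-- Every nonzero tangent vector of the foliation is `g`-spacelike. For a metric of index `q`, the
codimension-`q` foliations with this property are the space foliations. -/
def IsSpacelike (F : Foliation n q U) (g : BilinField n) : Prop :=
  ∀ x ∈ U, ∀ v, F.IsTangent x v → v ≠ 0 → BilinField.IsSpacelike g x v

end Foliation

/-! The metrics `g^c_n` on `ℝⁿ`, `n ≥ 3`. -/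

namespace TwistedMetric

open BilinField

variable {n : ℕ}

/-- The frame `e₀ = (1/c) ∂₀`, `e₁ = ∂₁ - x₂ ∂₀`, `e₂ = ∂₂`, and `eᵢ = ∂ᵢ` for `i ≥ 3`. -/
def frame (hn : 3 ≤ n) (c : ℝ) (x : Fin n → ℝ) (i : Fin n) : Fin n → ℝ :=
  if (i : ℕ) = 0 then (1 / c) • coordVec i
  else if (i : ℕ) = 1 then coordVec i - x ⟨2, by omega⟩ • coordVec ⟨0, by omega⟩
  else coordVec i

/-- The dual coframe of `frame`: `θ⁰ = c (dx₀ + x₂ dx₁)`, and `θⁱ = dxᵢ` for `i ≥ 1`. -/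
def coframe (hn : 3 ≤ n) (c : ℝ) (x : Fin n → ℝ) (i : Fin n) : (Fin n → ℝ) →ₗ[ℝ] ℝ :=
  if (i : ℕ) = 0 then
    c • (LinearMap.proj i + x ⟨2, by omega⟩ • LinearMap.proj ⟨1, by omega⟩)
  else LinearMap.proj i

/-- The signs `ε₀ = -1` and `εᵢ = 1` for `i ≥ 1`. -/
def sign (i : Fin n) : ℝ := if (i : ℕ) = 0 then -1 else 1

/-- The Lorentzian metric `g^c_n = ∑ᵢ εᵢ θⁱ ⊗ θⁱ` on `ℝⁿ`, for which `frame` is an orthonormal frame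
with `e₀` timelike. It is the product of `g^c_3` on `ℝ³` with the euclidean metric of `ℝ^{n-3}`. -/
def metric (hn : 3 ≤ n) (c : ℝ) : BilinField n := fun x =>
  ∑ i, sign i • LinearMap.BilinForm.linMulLin (coframe hn c x i) (coframe hn c x i)

theorem coframe_frame (hn : 3 ≤ n) {c : ℝ} (hc : c ≠ 0) (x : Fin n → ℝ) (i j : Fin n) :
    coframe hn c x i (frame hn c x j) = if i = j then 1 else 0 := by
  have h0 : ∀ k : Fin n, ((⟨0, by omega⟩ : Fin n) = k) ↔ ((k : ℕ) = 0) := fun k => by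
    rw [Fin.ext_iff]; exact eq_comm
  have h1 : ∀ k : Fin n, ((⟨1, by omega⟩ : Fin n) = k) ↔ ((k : ℕ) = 1) := fun k => by
    rw [Fin.ext_iff]; exact eq_comm
  simp only [coframe, frame, coordVec]
  split_ifs <;> simp_all [Pi.single_apply, Fin.ext_iff]

/-- `g^c_n` is the one bilinear form field with `g(eᵢ, eⱼ) = εᵢ δᵢⱼ`. -/
theorem metric_frame_unique (hn : 3 ≤ n) {c : ℝ} (hc : c ≠ 0) (x : Fin n → ℝ)
    (B : LinearMap.BilinForm ℝ (Fin n → ℝ)) :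
    (∀ i j, B (frame hn c x i) (frame hn c x j) = if i = j then sign i else 0) ↔
      B = metric hn c x := by
  have key : ∀ i j, metric hn c x (frame hn c x i) (frame hn c x j) =
      if i = j then sign i else 0 := by
    intro i j
    simp only [metric, LinearMap.sum_apply, LinearMap.smul_apply,
      LinearMap.BilinForm.linMulLin_apply, coframe_frame hn hc, smul_eq_mul]
    by_cases h : i = j <;> simp [h, eq_comm]
  have hli : LinearIndependent ℝ (frame hn c x) := by
    rw [Fintype.linearIndependent_iff]
    intro a ha i
    have := congrArg (coframe hn c x i) ha
    simpa [map_sum, coframe_frame hn hc] using this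
  have : Nonempty (Fin n) := ⟨⟨0, by omega⟩⟩
  let b := basisOfLinearIndependentOfCardEqFinrank hli (by simp)
  have hb : ∀ i, b i = frame hn c x i := fun i => by simp [b]
  constructor
  · intro h
    refine LinearMap.BilinForm.ext_basis b fun i j => ?_
    rw [hb, hb, h, key]
  · rintro rfl
    exact key

end TwistedMetric

end

noncomputable section

/-! ### Curvature of `metric` and the dominant energy condition. -/

namespace TwistedMetric

open BilinField

variable {n : ℕ}

/-! Obstruction. A vector with `g(v, v) ≥ 0` satisfies `c |θ(v)| ≤ |v'|`, where `θ = dx₀ + x₂ dx₁`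
and `v'` consists of the components `v₁, …, v_{n-1}`. Hence hyperplanes without timelike vectors are
`1/c`-close to `ker θ`, which is not integrable: `[e₁, e₂] = ∂₀` is transverse to it.
Quantitatively, `∂₀` is transverse to such a foliation, so there are tangent fields `X = ∂₁ - a ∂₀`
and `Y = ∂₂ - b ∂₀` with `|a - x₂| ≤ 1/c` and `|b| ≤ 1/c` (`exists_contDiffOn_isTangent_sub_smul`,
`abs_le_of_not_isTimelike`). Follow `Y` for time `r`, and push this curve along `X` for time `r`.
The pushed curve stays in a leaf (`isLeafwiseAt_transport`), so its `x₀`-slope is again `-b`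
(`hasDerivWithinAt_of_isLeafwiseAt`). The four sides form a closed loop; their changes in `x₀` would
add up to `±r²` if the planes were `ker θ`, and each side deviates by at most `r/c`. So `r² ≤ 4r/c`,
which fails for large `c` (`length_mul_le_of_not_isTimelike`).

Energy condition. In the orthonormal frame the energy-momentum tensor is diagonal, with entries
computed from the Christoffel symbols (`energyMomentum_metric`). A diagonal tensor satisfies the
dominant energy condition once its `e₀`-entry bounds the absolute values of all entries, and here
that entry is `3c²/4 - Λ`, which wins as soon as `4|Λ| ≤ c²`. -/

theorem index_cases (hn : 3 ≤ n) (i : Fin n) :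
    i = ⟨0, by omega⟩ ∨ i = ⟨1, by omega⟩ ∨ i = ⟨2, by omega⟩ ∨ 3 ≤ (i : ℕ) := by
  simp only [Fin.ext_iff]; omega

theorem sum_eq_three (hn : 3 ≤ n) {f : Fin n → ℝ} (hf : ∀ i : Fin n, 3 ≤ (i : ℕ) → f i = 0) :
    ∑ i, f i = f ⟨0, by omega⟩ + f ⟨1, by omega⟩ + f ⟨2, by omega⟩ := by
  obtain ⟨m, rfl⟩ := Nat.exists_eq_add_of_le' hn
  rw [Fin.sum_univ_succ, Fin.sum_univ_succ, Fin.sum_univ_succ, Finset.sum_eq_zero]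
  · simp only [add_zero, ← add_assoc]; rfl
  · intro i _
    exact hf _ (by simp)

/-- The components of `g^c_n` as functions of `y = x₂`. -/
def metricEntry (c y : ℝ) : ℕ → ℕ → ℝ
  | 0, 0 => -c ^ 2
  | 0, 1 => -c ^ 2 * y
  | 1, 0 => -c ^ 2 * y
  | 1, 1 => 1 - c ^ 2 * y ^ 2
  | i, j => if i = j then 1 else 0

/-- The components of the inverse of `g^c_n` as functions of `y = x₂`. -/
def invMetricEntry (c y : ℝ) : ℕ → ℕ → ℝ
  | 0, 0 => -(1 / c ^ 2) + y ^ 2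
  | 0, 1 => -y
  | 1, 0 => -y
  | 1, 1 => 1
  | i, j => if i = j then 1 else 0

/-- The `y`-derivative of `metricEntry`. -/
def metricEntryDeriv (c y : ℝ) : ℕ → ℕ → ℝ
  | 0, 1 => -c ^ 2
  | 1, 0 => -c ^ 2
  | 1, 1 => -(2 * c ^ 2 * y)
  | _, _ => 0

/-- The Christoffel symbols `Γᵏᵢⱼ` of `g^c_n` as functions of `y = x₂`. -/
def christoffelEntry (c y : ℝ) : ℕ → ℕ → ℕ → ℝ
  | 2, 0, 1 => c ^ 2 / 2
  | 2, 1, 0 => c ^ 2 / 2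
  | 2, 1, 1 => c ^ 2 * y
  | 0, 0, 2 => c ^ 2 * y / 2
  | 0, 2, 0 => c ^ 2 * y / 2
  | 1, 0, 2 => -(c ^ 2 / 2)
  | 1, 2, 0 => -(c ^ 2 / 2)
  | 0, 1, 2 => 1 / 2 + c ^ 2 * y ^ 2 / 2
  | 0, 2, 1 => 1 / 2 + c ^ 2 * y ^ 2 / 2
  | 1, 1, 2 => -(c ^ 2 * y / 2)
  | 1, 2, 1 => -(c ^ 2 * y / 2)
  | _, _, _ => 0

/-- The `y`-derivative of `christoffelEntry`. -/
def christoffelEntryDeriv (c y : ℝ) : ℕ → ℕ → ℕ → ℝ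
  | 2, 1, 1 => c ^ 2
  | 0, 0, 2 => c ^ 2 / 2
  | 0, 2, 0 => c ^ 2 / 2
  | 0, 1, 2 => c ^ 2 * y
  | 0, 2, 1 => c ^ 2 * y
  | 1, 1, 2 => -(c ^ 2 / 2)
  | 1, 2, 1 => -(c ^ 2 / 2)
  | _, _, _ => 0

theorem hasDerivAt_metricEntry (c y : ℝ) (i j : ℕ) :
    HasDerivAt (fun y => metricEntry c y i j) (metricEntryDeriv c y i j) y := by
  rcases i with _ | _ | i <;> rcases j with _ | _ | j <;>
    simp only [metricEntry, metricEntryDeriv] <;>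
    first
    | exact hasDerivAt_const _ _
    | simpa using (hasDerivAt_id y).const_mul (-c ^ 2)
    | exact (((hasDerivAt_pow 2 y).const_mul (c ^ 2)).const_sub 1).congr_deriv (by norm_num; ring)

theorem hasDerivAt_christoffelEntry (c y : ℝ) (k i j : ℕ) :
    HasDerivAt (fun y => christoffelEntry c y k i j) (christoffelEntryDeriv c y k i j) y := by
  have h1 := (hasDerivAt_id y).const_mul (c ^ 2)
  have h2 := ((((hasDerivAt_pow 2 y).const_mul (c ^ 2)).div_const 2).const_add (1 / 2))
  have h3 := h1.div_const 2
  have h4 := h3.neg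
  simp only [id, mul_one] at h1 h3 h4
  have h2' : HasDerivAt (fun y : ℝ => 1 / 2 + c ^ 2 * y ^ 2 / 2) (c ^ 2 * y) y :=
    h2.congr_deriv (by norm_num; ring)
  rcases k with _ | _ | _ | k <;> rcases i with _ | _ | _ | i <;> rcases j with _ | _ | _ | j <;>
    simp only [christoffelEntry, christoffelEntryDeriv] <;>
    first
    | exact hasDerivAt_const _ _
    | exact h1
    | exact h2'
    | exact h3
    | exact h4

/-- All components of the metric and of its connection depend on `x₂` alone, so this reduces every
partial derivative to a one-variable derivative that survives only for `∂₂`. -/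
theorem partialDeriv_comp_eval {p : ℝ → ℝ} {p' : ℝ} {k : Fin n} {x : Fin n → ℝ}
    (hp : HasDerivAt p p' (x k)) (i : Fin n) :
    partialDeriv i (fun y => p (y k)) x = if i = k then p' else 0 := by
  have h : HasFDerivAt (fun y : Fin n → ℝ => p (y k)) _ x :=
    hp.comp_hasFDerivAt x (ContinuousLinearMap.proj (R := ℝ) (φ := fun _ : Fin n => ℝ) k).hasFDerivAt
  rw [partialDeriv, h.fderiv]
  simp [coordVec, Pi.single_apply, eq_comm]

theorem coframe_coordVec (hn : 3 ≤ n) (c : ℝ) (x : Fin n → ℝ) (i j : Fin n) :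
    coframe hn c x i (coordVec j) =
      if (i : ℕ) = 0 then
        if (j : ℕ) = 0 then c else if (j : ℕ) = 1 then c * x ⟨2, by omega⟩ else 0
      else if i = j then 1 else 0 := by
  simp only [coframe, coordVec]
  split_ifs <;> simp_all [Pi.single_apply, Fin.ext_iff, eq_comm]

theorem sum_coframe_coordVec (hn : 3 ≤ n) (c : ℝ) (x : Fin n → ℝ) (r : Fin n → ℝ) (j : Fin n) :
    ∑ i, r i * coframe hn c x i (coordVec j) =
      r ⟨0, by omega⟩ *
          (if (j : ℕ) = 0 then c else if (j : ℕ) = 1 then c * x ⟨2, by omega⟩ else 0) +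
        if (j : ℕ) = 0 then 0 else r j := by
  have : ∀ i, r i * coframe hn c x i (coordVec j) =
      (if i = ⟨0, by omega⟩ then r i * (if (j : ℕ) = 0 then c else
        if (j : ℕ) = 1 then c * x ⟨2, by omega⟩ else 0) else 0) +
      (if i = j then if (j : ℕ) = 0 then 0 else r j else 0) := by
    intro i
    rw [coframe_coordVec]
    simp only [Fin.ext_iff]
    by_cases hi : (i : ℕ) = 0 <;> by_cases hj : (i : ℕ) = j
    · simp [hi, show (j : ℕ) = 0 by omega]
    · simp [hi, show ¬ 0 = (j : ℕ) by omega]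
    · obtain rfl := Fin.ext hj
      simp [hi]
    · simp [hi, hj]
  simp only [this, Finset.sum_add_distrib, Finset.sum_ite_eq', Finset.mem_univ,
    if_true]

/-- The diagonal bilinear form `∑ᵢ rᵢ θⁱ ⊗ θⁱ`. -/
def diagForm (hn : 3 ≤ n) (c : ℝ) (r : Fin n → ℝ) : BilinField n := fun x =>
  ∑ i, r i • LinearMap.BilinForm.linMulLin (coframe hn c x i) (coframe hn c x i)

theorem diagForm_apply (hn : 3 ≤ n) (c : ℝ) (r : Fin n → ℝ) (x v w : Fin n → ℝ) :
    diagForm hn c r x v w = ∑ i, r i * (coframe hn c x i v * coframe hn c x i w) := by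
  simp [diagForm, LinearMap.sum_apply]

theorem metric_eq_diagForm (hn : 3 ≤ n) (c : ℝ) : metric hn c = diagForm hn c sign := rfl

theorem diagForm_coordVec (hn : 3 ≤ n) (c : ℝ) (r : Fin n → ℝ) (x : Fin n → ℝ) (i j : Fin n) :
    diagForm hn c r x (coordVec i) (coordVec j) =
      r ⟨0, by omega⟩ *
          ((if (i : ℕ) = 0 then c else if (i : ℕ) = 1 then c * x ⟨2, by omega⟩ else 0) *
          (if (j : ℕ) = 0 then c else if (j : ℕ) = 1 then c * x ⟨2, by omega⟩ else 0)) +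
        if (i : ℕ) = j ∧ (j : ℕ) ≠ 0 then r j else 0 := by
  rw [diagForm_apply]
  simp only [← mul_assoc]
  rw [sum_coframe_coordVec]
  simp only [coframe_coordVec, if_true]
  by_cases h : (j : ℕ) = 0
  · simp [h, mul_assoc]
  · simp [h, mul_assoc, Fin.ext_iff, eq_comm]

theorem components_metric (hn : 3 ≤ n) (c : ℝ) (x : Fin n → ℝ) (i j : Fin n) :
    components (metric hn c) x i j = metricEntry c (x ⟨2, by omega⟩) i j := by
  rw [components, Matrix.of_apply, metric_eq_diagForm, diagForm_coordVec]
  obtain ⟨i, hi⟩ := i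
  obtain ⟨j, hj⟩ := j
  rcases i with _ | _ | i <;> rcases j with _ | _ | j <;> simp [metricEntry, sign] <;> ring

theorem invComponents_metric (hn : 3 ≤ n) {c : ℝ} (hc : c ≠ 0) (x : Fin n → ℝ) (i j : Fin n) :
    invComponents (metric hn c) x i j = invMetricEntry c (x ⟨2, by omega⟩) i j := by
  have : components (metric hn c) x *
      Matrix.of (fun i j : Fin n => invMetricEntry c (x ⟨2, by omega⟩) i j) = 1 := by
    ext i j
    simp only [Matrix.mul_apply, Matrix.of_apply, components_metric, Matrix.one_apply]
    rcases index_cases hn i with rfl | rfl | rfl | hi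
    · rw [sum_eq_three hn]
      · obtain ⟨j, hj⟩ := j
        rcases j with _ | _ | _ | j <;> simp [metricEntry, invMetricEntry]
        field_simp
        ring
      · intro i hi
        obtain ⟨m, hm⟩ := Nat.exists_eq_add_of_le' hi
        simp [hm, metricEntry]
    · rw [sum_eq_three hn]
      · obtain ⟨j, hj⟩ := j
        rcases j with _ | _ | _ | j <;> simp [metricEntry, invMetricEntry] <;> field_simp <;> ring
      · intro i hi
        obtain ⟨m, hm⟩ := Nat.exists_eq_add_of_le' hi
        simp [hm, metricEntry]
    · rw [sum_eq_three hn]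
      · obtain ⟨j, hj⟩ := j
        rcases j with _ | _ | _ | j <;> simp [metricEntry, invMetricEntry]
      · intro i hi
        obtain ⟨m, hm⟩ := Nat.exists_eq_add_of_le' hi
        simp [hm, metricEntry]
    · obtain ⟨m, hm⟩ := Nat.exists_eq_add_of_le' hi
      have h : ∀ l : ℕ, metricEntry c (x ⟨2, by omega⟩) i l = if (i : ℕ) = l then 1 else 0 := by
        intro l; simp [hm, metricEntry]
      simp only [h, ← Fin.ext_iff, ite_mul, one_mul, zero_mul, Finset.sum_ite_eq,
        Finset.mem_univ, if_true]
      rw [hm]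
      simp [invMetricEntry, Fin.ext_iff, hm]
  rw [invComponents, Matrix.inv_eq_right_inv this, Matrix.of_apply]

theorem partialDeriv_components (hn : 3 ≤ n) (c : ℝ) (x : Fin n → ℝ) (k i j : Fin n) :
    partialDeriv k (fun y => components (metric hn c) y i j) x =
      if (k : ℕ) = 2 then metricEntryDeriv c (x ⟨2, by omega⟩) i j else 0 := by
  simp only [components_metric]
  rw [partialDeriv_comp_eval (p := fun y => metricEntry c y i j) (hasDerivAt_metricEntry c _ i j)]
  simp [Fin.ext_iff]

set_option maxHeartbeats 1000000 in
theorem christoffel_metric (hn : 3 ≤ n) {c : ℝ} (hc : c ≠ 0) (k i j : Fin n) (x : Fin n → ℝ) :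
    christoffel (metric hn c) k i j x = christoffelEntry c (x ⟨2, by omega⟩) k i j := by
  simp only [christoffel, partialDeriv_components, invComponents_metric hn hc]
  rw [sum_eq_three hn]
  · obtain ⟨k, hk⟩ := k
    obtain ⟨i, hi⟩ := i
    obtain ⟨j, hj⟩ := j
    rcases k with _ | _ | _ | k <;> rcases i with _ | _ | _ | i <;>
      rcases j with _ | _ | _ | j <;>
      simp [christoffelEntry, invMetricEntry, metricEntryDeriv] <;> field_simp <;> ring
  · intro l hl
    obtain ⟨m, hm⟩ := Nat.exists_eq_add_of_le' hl
    simp [hm, metricEntryDeriv]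

theorem partialDeriv_christoffel (hn : 3 ≤ n) {c : ℝ} (hc : c ≠ 0) (l k i j : Fin n)
    (x : Fin n → ℝ) :
    partialDeriv l (christoffel (metric hn c) k i j) x =
      if (l : ℕ) = 2 then christoffelEntryDeriv c (x ⟨2, by omega⟩) k i j else 0 := by
  have : christoffel (metric hn c) k i j =
      fun y => (fun y => christoffelEntry c y k i j) (y ⟨2, by omega⟩) := by
    funext y
    exact christoffel_metric hn hc k i j y
  rw [this, partialDeriv_comp_eval (hasDerivAt_christoffelEntry c _ k i j)]
  simp [Fin.ext_iff]

/-- The eigenvalues of the Ricci tensor of `g^c_n` in the frame `frame`. -/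
def ricciEntry (c : ℝ) (i : Fin n) : ℝ := if (i : ℕ) < 3 then c ^ 2 / 2 else 0

set_option maxHeartbeats 1000000 in
theorem ricci_metric (hn : 3 ≤ n) {c : ℝ} (hc : c ≠ 0) :
    ricci (metric hn c) = diagForm hn c (ricciEntry c) := by
  funext x
  refine LinearMap.BilinForm.ext_basis (Pi.basisFun ℝ (Fin n)) fun j k => ?_
  simp only [Pi.basisFun_apply]
  change _ = diagForm hn c (ricciEntry c) x (coordVec j) (coordVec k)
  rw [diagForm_coordVec, ricci, Matrix.toBilin'_single, Matrix.of_apply]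
  simp only [riemann, partialDeriv_christoffel hn hc, christoffel_metric hn hc]
  -- The euclidean factor is flat and splits off, so both the trace and the quadratic sum reduce to
  -- the indices 0, 1, 2.
  have hz : ∀ k i j : ℕ, (3 ≤ k ∨ 3 ≤ i ∨ 3 ≤ j) →
      christoffelEntry c (x ⟨2, by omega⟩) k i j = 0 ∧
      christoffelEntryDeriv c (x ⟨2, by omega⟩) k i j = 0 := by
    intro k i j h
    rcases k with _ | _ | _ | k <;> rcases i with _ | _ | _ | i <;>
      rcases j with _ | _ | _ | j <;>
      first | omega | simp [christoffelEntry, christoffelEntryDeriv]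
  have hs := fun i : Fin n => sum_eq_three hn
    (f := fun m : Fin n => christoffelEntry c (x ⟨2, by omega⟩) i i m *
        christoffelEntry c (x ⟨2, by omega⟩) m j k -
      christoffelEntry c (x ⟨2, by omega⟩) i j m * christoffelEntry c (x ⟨2, by omega⟩) m i k)
    (fun m hm => by simp [hz _ _ (m : ℕ) (Or.inr (Or.inr hm))])
  simp only [hs]
  rw [sum_eq_three hn]
  · clear hs
    obtain ⟨j, hj⟩ := j
    obtain ⟨k, hk⟩ := k
    rcases j with _ | _ | _ | j <;> rcases k with _ | _ | _ | k <;>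
      simp [christoffelEntry, christoffelEntryDeriv, ricciEntry] <;> ring
  · intro i hi
    have : (i : ℕ) ≠ 2 := by omega
    simp [this, hz i _ _ (Or.inl hi)]

theorem scal_metric (hn : 3 ≤ n) {c : ℝ} (hc : c ≠ 0) (x : Fin n → ℝ) :
    scal (metric hn c) x = c ^ 2 / 2 := by
  simp only [scal, ricci_metric hn hc, components, Matrix.of_apply, diagForm_coordVec,
    invComponents_metric hn hc]
  have h : ∀ i j : Fin n, 3 ≤ (i : ℕ) ∨ 3 ≤ (j : ℕ) →
      invMetricEntry c (x ⟨2, by omega⟩) i j * (ricciEntry c (⟨0, by omega⟩ : Fin n) *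
        ((if (i : ℕ) = 0 then c else if (i : ℕ) = 1 then c * x ⟨2, by omega⟩ else 0) *
          (if (j : ℕ) = 0 then c else if (j : ℕ) = 1 then c * x ⟨2, by omega⟩ else 0)) +
        if (i : ℕ) = j ∧ (j : ℕ) ≠ 0 then ricciEntry c j else 0) = 0 := by
    intro i j hij
    by_cases hj : 3 ≤ (j : ℕ)
    · simp [ricciEntry, show (j : ℕ) ≠ 0 by omega, show (j : ℕ) ≠ 1 by omega,
        show ¬ (j : ℕ) < 3 by omega]
    · have hi : 3 ≤ (i : ℕ) := hij.resolve_right hj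
      simp [show (i : ℕ) ≠ 0 by omega, show (i : ℕ) ≠ 1 by omega, show (i : ℕ) ≠ j by omega]
  have hs : ∀ i : Fin n, _ := fun i => sum_eq_three hn (fun j hj => h i j (Or.inr hj))
  rw [sum_eq_three hn fun i hi => Finset.sum_eq_zero fun j _ => h i j (Or.inl hi),
    hs, hs, hs]
  simp [invMetricEntry, ricciEntry]
  field_simp
  ring

/-- The eigenvalues of the energy-momentum tensor of `g^c_n` in the frame `frame`. -/
def energyEntry (c Λ : ℝ) (i : Fin n) : ℝ :=
  if (i : ℕ) = 0 then 3 * c ^ 2 / 4 - Λ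
  else if (i : ℕ) < 3 then c ^ 2 / 4 + Λ else -(c ^ 2 / 4) + Λ

theorem energyMomentum_metric (hn : 3 ≤ n) {c : ℝ} (hc : c ≠ 0) (Λ : ℝ) :
    energyMomentum (metric hn c) Λ = diagForm hn c (energyEntry c Λ) := by
  funext x
  rw [energyMomentum, ricci_metric hn hc, scal_metric hn hc, metric_eq_diagForm]
  refine LinearMap.ext₂ fun v w => ?_
  simp only [LinearMap.add_apply, LinearMap.sub_apply, LinearMap.smul_apply, diagForm_apply,
    smul_eq_mul, Finset.mul_sum, ← Finset.sum_sub_distrib, ← Finset.sum_add_distrib]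
  refine Finset.sum_congr rfl fun i _ => ?_
  simp only [ricciEntry, sign, energyEntry]
  split_ifs <;> first | omega | ring

/-- In an orthonormal frame, raising an index only inserts the sign `εᵢ`; this keeps the
semi-dominant condition diagonal. -/
theorem coframe_sharp (hn : 3 ≤ n) {c : ℝ} (hc : c ≠ 0) (x : Fin n → ℝ)
    (α : (Fin n → ℝ) →ₗ[ℝ] ℝ) (i : Fin n) :
    coframe hn c x i (sharp (metric hn c) x α) = sign i * α (frame hn c x i) := by
  have key : ∀ k, sharp (metric hn c) x α k =
      ∑ j : Fin n, invMetricEntry c (x ⟨2, by omega⟩) k j * α (coordVec j) := by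
    intro k
    simp [sharp, Matrix.mulVec, dotProduct, invComponents_metric hn hc]
  have key0 : sharp (metric hn c) x α ⟨0, by omega⟩ =
      (-(1 / c ^ 2) + x ⟨2, by omega⟩ ^ 2) * α (coordVec ⟨0, by omega⟩)
        - x ⟨2, by omega⟩ * α (coordVec ⟨1, by omega⟩) := by
    rw [key, sum_eq_three hn]
    · simp [invMetricEntry]; ring
    · intro i hi
      obtain ⟨m, hm⟩ := Nat.exists_eq_add_of_le' hi
      simp [hm, invMetricEntry]
  have key1 : sharp (metric hn c) x α ⟨1, by omega⟩ =
      - x ⟨2, by omega⟩ * α (coordVec ⟨0, by omega⟩) + α (coordVec ⟨1, by omega⟩) := by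
    rw [key, sum_eq_three hn]
    · simp [invMetricEntry]
    · intro i hi
      obtain ⟨m, hm⟩ := Nat.exists_eq_add_of_le' hi
      simp [hm, invMetricEntry]
  by_cases h0 : (i : ℕ) = 0
  · rw [show i = ⟨0, by omega⟩ from Fin.ext h0]
    simp only [coframe, frame, sign, if_true, LinearMap.smul_apply, LinearMap.add_apply,
      LinearMap.proj_apply, key0, key1, map_smul, smul_eq_mul]
    field_simp
    ring
  by_cases h1 : (i : ℕ) = 1
  · rw [show i = ⟨1, by omega⟩ from Fin.ext h1]
    simp [coframe, frame, sign, key1]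
    ring
  · have h : ∀ l : Fin n, invMetricEntry c (x ⟨2, by omega⟩) i l = if i = l then 1 else 0 := by
      intro l
      obtain ⟨m, hm⟩ := Nat.exists_eq_add_of_le' (show 2 ≤ (i : ℕ) by omega)
      simp [hm, invMetricEntry, Fin.ext_iff]
    simp [coframe, frame, sign, h0, h1, key, h]

theorem diagForm_frame (hn : 3 ≤ n) {c : ℝ} (hc : c ≠ 0) (r : Fin n → ℝ) (x v : Fin n → ℝ)
    (i : Fin n) :
    diagForm hn c r x v (frame hn c x i) = r i * coframe hn c x i v := by
  simp [diagForm_apply, coframe_frame hn hc]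

/-- The binding case is `i = 1, 2`, where `c²/4 + Λ ≤ 3c²/4 - Λ` amounts to `4Λ ≤ c²`. -/
theorem energyEntry_abs_le {c Λ : ℝ} (h : 4 * |Λ| ≤ c ^ 2) (i : Fin n) :
    |energyEntry c Λ i| ≤ 3 * c ^ 2 / 4 - Λ := by
  have h1 := le_abs_self Λ
  have h2 := neg_abs_le Λ
  simp only [energyEntry]
  split_ifs <;> rw [abs_le] <;> constructor <;> linarith

/-- With `|Tᵢ| ≤ T₀ = ρ`, comparing summand by summand gives `T(v, v) ≥ -ρ g(v, v)` and `g(♯T(v, ·),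
♯T(v, ·)) ≤ ρ² g(v, v)`, with equality in the summand of `e₀`. -/
theorem dominantEnergyCondition_metric (hn : 3 ≤ n) {c : ℝ} (hc : c ≠ 0) {Λ : ℝ}
    (h : 4 * |Λ| ≤ c ^ 2) : DominantEnergyCondition (metric hn c) Λ := by
  set ρ := 3 * c ^ 2 / 4 - Λ with hρ
  let i₀ : Fin n := ⟨0, by omega⟩
  have h0 : energyEntry c Λ i₀ = ρ := by simp [energyEntry, i₀, hρ]
  have hρ0 : 0 ≤ ρ := (abs_nonneg _).trans (energyEntry_abs_le h i₀)
  constructor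
  · intro x v hv
    rw [IsTimelike, metric_eq_diagForm, diagForm_apply] at hv
    rw [energyMomentum_metric hn hc, diagForm_apply]
    have : ∑ i, -(ρ * (sign i * (coframe hn c x i v * coframe hn c x i v))) ≤
        ∑ i, energyEntry c Λ i * (coframe hn c x i v * coframe hn c x i v) := by
      refine Finset.sum_le_sum fun i _ => ?_
      have h1 := neg_le_of_abs_le (energyEntry_abs_le h i)
      have h2 := mul_self_nonneg (coframe hn c x i v)
      by_cases hi : (i : ℕ) = 0
      · obtain rfl : i = i₀ := Fin.ext hi
        simp [h0, sign, i₀]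
      · simp only [sign, hi, if_false]
        nlinarith
    rw [Finset.sum_neg_distrib, ← Finset.mul_sum] at this
    nlinarith
  · intro x v hv
    rw [IsTimelike, metric_eq_diagForm, diagForm_apply] at hv
    rw [BilinField.IsSpacelike, not_lt]
    have e : ∀ w, metric hn c x (-w) (-w) = diagForm hn c sign x w w := by
      intro w; simp [metric_eq_diagForm]
    rw [e, diagForm_apply, energyMomentum_metric hn hc]
    simp only [coframe_sharp hn hc, diagForm_frame hn hc]
    have : ∑ i, sign i * ((sign i * (energyEntry c Λ i * coframe hn c x i v)) *
          (sign i * (energyEntry c Λ i * coframe hn c x i v))) ≤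
        ∑ i, ρ ^ 2 * (sign i * (coframe hn c x i v * coframe hn c x i v)) := by
      refine Finset.sum_le_sum fun i _ => ?_
      have h1 : energyEntry c Λ i ^ 2 ≤ ρ ^ 2 :=
        sq_le_sq' (neg_le_of_abs_le (energyEntry_abs_le h i))
          (le_of_abs_le (energyEntry_abs_le h i))
      have h2 := mul_self_nonneg (coframe hn c x i v)
      by_cases hi : (i : ℕ) = 0
      · obtain rfl : i = i₀ := Fin.ext hi
        rw [h0]
        simp only [sign, hi, if_true]
        linarith
      · simp only [sign, hi, if_false]
        nlinarith
    rw [← Finset.mul_sum] at this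
    exact this.trans (mul_nonpos_of_nonneg_of_nonpos (sq_nonneg _) hv.le)

end TwistedMetric

/-! ### Flows and the mean value inequality. -/

section

open Set Metric Filter

/-- A bounded Lipschitz vector field on a ball has a flow, which is continuous and stays in the
ball for as long as its speed permits. -/
theorem exists_continuousOn_flow {E : Type*} [NormedAddCommGroup E] [NormedSpace ℝ E]
    [CompleteSpace E] {V : E → E} {x₀ : E} {a r L K : NNReal} {T : ℝ} (hT : 0 ≤ T)
    (hb : ∀ x ∈ closedBall x₀ a, ‖V x‖ ≤ L) (hl : LipschitzOnWith K V (closedBall x₀ a))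
    (hm : L * T ≤ a - r) :
    ∃ α : E → ℝ → E, (∀ x ∈ closedBall x₀ (r : ℝ), α x 0 = x ∧ ∀ t ∈ Icc 0 T,
      α x t ∈ closedBall x₀ (a : ℝ) ∧ HasDerivWithinAt (α x) (V (α x t)) (Icc 0 T) t) ∧
      ContinuousOn (fun z : E × ℝ => α z.1 z.2) (closedBall x₀ (r : ℝ) ×ˢ Icc 0 T) := by
  classical
  let t₀ : Icc (0 : ℝ) T := ⟨0, le_rfl, hT⟩
  have hf : IsPicardLindelof (fun _ => V) t₀ x₀ a r L K :=
    IsPicardLindelof.of_time_independent hb hl (by simpa [t₀, hT] using hm)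
  -- The curves are kept as fixed points of the Picard operator: in this form they stay in the ball
  -- and depend on `x` in a Lipschitz way.
  choose! α hα using fun x (hx : x ∈ closedBall x₀ (r : ℝ)) =>
    ODE.FunSpace.exists_isFixedPt_next hf hx
  have h0 : ∀ x ∈ closedBall x₀ (r : ℝ), (α x).compProj 0 = x ∧ ∀ t ∈ Icc 0 T,
      (α x).compProj t ∈ closedBall x₀ (a : ℝ) ∧
        HasDerivWithinAt (α x).compProj (V ((α x).compProj t)) (Icc 0 T) t := by
    intro x hx
    refine ⟨?_, fun t ht => ⟨(α x).compProj_mem_closedBall hf.mul_max_le, ?_⟩⟩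
    · change (α x).compProj (t₀ : ℝ) = x
      rw [ODE.FunSpace.compProj_val, ← hα x hx, ODE.FunSpace.next_apply₀]
    · refine (ODE.hasDerivWithinAt_picard_Icc t₀.2 hf.continuousOn_uncurry
        (α x).continuous_compProj.continuousOn
        (fun _ _ => (α x).compProj_mem_closedBall hf.mul_max_le) x ht).congr_of_mem ?_ ht
      intro t' ht'
      nth_rw 1 [← hα x hx]
      rw [ODE.FunSpace.compProj_of_mem ht', ODE.FunSpace.next_apply]
  refine ⟨fun x => (α x).compProj, h0, ?_⟩
  obtain ⟨L', h⟩ := ODE.FunSpace.exists_forall_closedBall_funSpace_dist_le_mul hf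
  refine continuousOn_prod_of_continuousOn_lipschitzOnWith _ L'
    (fun x hx => HasDerivWithinAt.continuousOn fun t ht => ((h0 x hx).2 t ht).2)
    fun t ht => LipschitzOnWith.of_dist_le_mul fun x hx y hy => ?_
  simp only
  rw [ODE.FunSpace.compProj_apply, ODE.FunSpace.compProj_apply,
    ← ODE.FunSpace.toContinuousMap_apply_eq_apply, ← ODE.FunSpace.toContinuousMap_apply_eq_apply]
  have : Nonempty (Icc (0 : ℝ) T) := ⟨t₀⟩
  exact ContinuousMap.dist_le_iff_of_nonempty.mp
    (h x y hx hy (α x) (α y) (hα x hx) (hα y hy)) _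

/-- Mean value inequality for `u t - t * m`. With `ε = 0` it determines coordinates exactly; with `ε
= 1 / c` it bounds the drift of `x₀`. -/
theorem abs_sub_sub_mul_le_of_hasDerivWithinAt {u u' : ℝ → ℝ} {T m ε : ℝ}
    (hu : ∀ t ∈ Icc 0 T, HasDerivWithinAt u (u' t) (Icc 0 T) t)
    (h : ∀ t ∈ Icc 0 T, |u' t - m| ≤ ε) {t : ℝ} (ht : t ∈ Icc 0 T) :
    |u t - u 0 - t * m| ≤ ε * t := by
  have hd : ∀ t ∈ Icc 0 T, HasDerivWithinAt (fun t => u t - t * m) (u' t - m) (Icc 0 T) t := by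
    intro t ht
    exact ((hu t ht).sub ((hasDerivWithinAt_id t _).mul_const m)).congr_deriv (by simp)
  have := (convex_Icc 0 T).norm_image_sub_le_of_norm_hasDerivWithin_le hd h
    (left_mem_Icc.2 (ht.1.trans ht.2)) ht
  simp only [Real.norm_eq_abs, zero_mul, sub_zero, abs_of_nonneg ht.1] at this
  convert this using 2
  ring

/-! ### Tangent vectors and leafwise curves of a foliation. -/

namespace Foliation

variable {n q : ℕ} {U : Set (Fin n → ℝ)} (F : Foliation n q U)

variable {F} in
theorem hasFDerivAt_chart {φ} (hφ : φ ∈ F.atlas) {x : Fin n → ℝ} (hx : x ∈ φ.source) :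
    HasFDerivAt φ (fderiv ℝ φ x) x :=
  (((F.smooth φ hφ).contDiffAt (φ.open_source.mem_nhds hx)).differentiableAt (by simp)).hasFDerivAt

variable {F} in
theorem hasFDerivAt_chart_snd {φ} (hφ : φ ∈ F.atlas) {x : Fin n → ℝ} (hx : x ∈ φ.source) :
    HasFDerivAt (fun y => (φ y).2)
      ((ContinuousLinearMap.snd ℝ _ _).comp (fderiv ℝ φ x)) x :=
  hasFDerivAt_snd.comp x (hasFDerivAt_chart hφ hx)

variable {F} in
theorem exists_eventually_snd_eq {φ ψ} (hφ : φ ∈ F.atlas) (hψ : ψ ∈ F.atlas) {x : Fin n → ℝ}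
    (hxφ : x ∈ φ.source) (hxψ : x ∈ ψ.source) :
    ∃ h : (Fin q → ℝ) → (Fin q → ℝ), (∀ᶠ w in 𝓝 (φ x), (ψ (φ.symm w)).2 = h w.2) ∧
      ∀ᶠ y in 𝓝 x, (ψ y).2 = h (φ y).2 := by
  obtain ⟨h, hh⟩ := F.compatible φ hφ ψ hψ (φ x) (by simp [hxφ, hxψ])
  refine ⟨h, hh, ?_⟩
  filter_upwards [(φ.continuousAt hxφ).eventually hh, φ.open_source.mem_nhds hxφ] with y hy hyφ
  rwa [φ.left_inv hyφ] at hy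

variable {F} in
/-- Tangency does not depend on the chart. -/
theorem IsTangent.snd_fderiv_eq_zero {x v : Fin n → ℝ} (hv : F.IsTangent x v) {ψ}
    (hψ : ψ ∈ F.atlas) (hxψ : x ∈ ψ.source) : (fderiv ℝ ψ x v).2 = 0 := by
  obtain ⟨φ, hφ, hxφ, h0⟩ := hv
  obtain ⟨h, hh, -⟩ := exists_eventually_snd_eq hφ hψ hxφ hxψ
  have hφt : φ x ∈ φ.target := φ.map_source hxφ
  have hs : HasFDerivAt φ.symm (fderiv ℝ φ.symm (φ x)) (φ x) :=
    (((F.smooth_symm φ hφ).contDiffAt (φ.open_target.mem_nhds hφt)).differentiableAt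
      (by simp)).hasFDerivAt
  have hinv : fderiv ℝ φ.symm (φ x) (fderiv ℝ φ x v) = v := by
    have h1 := hs.comp x (hasFDerivAt_chart hφ hxφ)
    have h2 : HasFDerivAt (φ.symm ∘ φ) (ContinuousLinearMap.id ℝ _) x :=
      (hasFDerivAt_id x).congr_of_eventuallyEq (by
        filter_upwards [φ.open_source.mem_nhds hxφ] with y hy
        simp [φ.left_inv hy])
    simpa using congrArg (fun A => A v) (h1.unique h2)
  -- Nothing is assumed about the regularity of `h`, so the chain rule cannot be applied to it.
  -- Instead, the transition map is differentiated along the line `φ x + t • w`, on which the second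
  -- component, hence `h` of it, is constant.
  set w := fderiv ℝ φ x v with hw
  have hline : HasDerivAt (fun t : ℝ => φ x + t • w) w 0 := by
    simpa using ((hasDerivAt_id (0 : ℝ)).smul_const w).const_add (φ x)
  have hψs : HasFDerivAt (fun y => (ψ y).2)
      ((ContinuousLinearMap.snd ℝ _ _).comp (fderiv ℝ ψ x)) (φ.symm (φ x)) := by
    rw [φ.left_inv hxφ]
    exact hasFDerivAt_chart_snd hψ hxψ
  have hcomp : HasFDerivAt (fun w => (ψ (φ.symm w)).2)
      (((ContinuousLinearMap.snd ℝ _ _).comp (fderiv ℝ ψ x)).comp (fderiv ℝ φ.symm (φ x)))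
      (φ x + (0 : ℝ) • w) := by
    rw [zero_smul, add_zero]
    exact hψs.comp (φ x) hs
  have h1 := hcomp.comp_hasDerivAt (0 : ℝ) hline
  have hconst : (fun t : ℝ => (ψ (φ.symm (φ x + t • w))).2) =ᶠ[𝓝 0] fun _ => h (φ x).2 := by
    have hc : Tendsto (fun t : ℝ => φ x + t • w) (𝓝 0) (𝓝 (φ x)) := by
      simpa using hline.continuousAt.tendsto
    filter_upwards [hc.eventually hh] with t ht
    rw [ht, Prod.snd_add, Prod.smul_snd, h0, smul_zero, add_zero]
  have h2 := (hasDerivAt_const (0 : ℝ) (h (φ x).2)).congr_of_eventuallyEq hconst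
  have h3 := h1.unique h2
  simpa [hinv] using h3

theorem isTangent_iff {φ} (hφ : φ ∈ F.atlas) {x v : Fin n → ℝ} (hx : x ∈ φ.source) :
    F.IsTangent x v ↔ (fderiv ℝ φ x v).2 = 0 :=
  ⟨fun h => h.snd_fderiv_eq_zero hφ hx, fun h => ⟨φ, hφ, hx, h⟩⟩

/-- In codimension one, every vector becomes tangent after adding a multiple of a given transverse
vector, and the coefficient depends smoothly on the base point. -/
theorem exists_contDiffOn_isTangent_sub_smul {U : Set (Fin n → ℝ)} (F : Foliation n 1 U)
    {e : Fin n → ℝ} (he : ∀ x ∈ U, ¬ F.IsTangent x e) (w : Fin n → ℝ) :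
    ∃ a : (Fin n → ℝ) → ℝ, ContDiffOn ℝ 1 a U ∧ ∀ x ∈ U, F.IsTangent x (w - a x • e) := by
  have hne : ∀ φ ∈ F.atlas, ∀ x ∈ φ.source, (fderiv ℝ φ x e).2 0 ≠ 0 := by
    intro φ hφ x hx h
    refine he x (F.source_subset φ hφ hx) ⟨φ, hφ, hx, ?_⟩
    ext i
    rw [Subsingleton.elim i 0, h, Pi.zero_apply]
  have hiff : ∀ φ ∈ F.atlas, ∀ x ∈ φ.source, ∀ s : ℝ, F.IsTangent x (w - s • e) ↔
      s = (fderiv ℝ φ x w).2 0 / (fderiv ℝ φ x e).2 0 := by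
    intro φ hφ x hx s
    rw [F.isTangent_iff hφ hx, eq_div_iff (hne φ hφ x hx), funext_iff, Fin.forall_fin_one]
    simp only [map_sub, map_smul, Prod.snd_sub, Prod.smul_snd, Pi.sub_apply, Pi.smul_apply,
      smul_eq_mul, Pi.zero_apply, sub_eq_zero]
    exact eq_comm
  obtain rfl | ⟨z, hz⟩ := U.eq_empty_or_nonempty
  · exact ⟨0, contDiffOn_const, by simp⟩
  have : Nonempty (OpenPartialHomeomorph (Fin n → ℝ) ((Fin (n - 1) → ℝ) × (Fin 1 → ℝ))) :=
    ⟨(F.exists_chart z hz).choose⟩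
  choose! c hc hxc using F.exists_chart
  refine ⟨fun x => (fderiv ℝ (c x) x w).2 0 / (fderiv ℝ (c x) x e).2 0, fun x hx => ?_,
    fun x hx => (hiff _ (hc x hx) x (hxc x hx) _).2 rfl⟩
  refine ContDiffAt.contDiffWithinAt ?_
  have hd : ContDiffAt ℝ 1 (fderiv ℝ (c x)) x :=
    ((F.smooth _ (hc x hx)).contDiffAt ((c x).open_source.mem_nhds (hxc x hx))).fderiv_right
      (m := 1) (by norm_cast)
  have hv : ∀ v, ContDiffAt ℝ 1 (fun y => (fderiv ℝ (c x) y v).2 0) x := fun v =>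
    contDiffAt_pi.1 (contDiff_snd.contDiffAt.comp x (hd.clm_apply contDiffAt_const)) 0
  refine ((hv w).div (hv e) (hne _ (hc x hx) x (hxc x hx))).congr_of_eventuallyEq ?_
  -- The chart `c y` varies arbitrarily with `y`. By `hiff` the coefficient is determined by
  -- tangency alone, so near `x` the single chart `c x` computes it.
  filter_upwards [(c x).open_source.mem_nhds (hxc x hx)] with y hy
  have hyU := F.source_subset _ (hc x hx) hy
  exact (hiff _ (hc x hx) y hy _).1 ((hiff _ (hc y hyU) y (hxc y hyU) _).2 rfl)

/-- The curve `σ`, defined on `I`, stays in its leaf near the parameter `s`. -/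
def IsLeafwiseAt (I : Set ℝ) (σ : ℝ → Fin n → ℝ) (s : ℝ) : Prop :=
  ∃ φ ∈ F.atlas, σ s ∈ φ.source ∧ ∀ᶠ s' in 𝓝[I] s, (φ (σ s')).2 = (φ (σ s)).2

-- Chart independence. Being leafwise replaces tangency of the velocity for curves known only to be
-- continuous, such as those moved by a flow.
variable {F} in
theorem IsLeafwiseAt.eventually_snd_eq {I : Set ℝ} {σ : ℝ → Fin n → ℝ} {s : ℝ}
    (h : F.IsLeafwiseAt I σ s) (hσ : ContinuousWithinAt σ I s) {ψ} (hψ : ψ ∈ F.atlas)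
    (hs : σ s ∈ ψ.source) : ∀ᶠ s' in 𝓝[I] s, (ψ (σ s')).2 = (ψ (σ s)).2 := by
  obtain ⟨φ, hφ, hsφ, hev⟩ := h
  obtain ⟨k, -, hk⟩ := exists_eventually_snd_eq hφ hψ hsφ hs
  filter_upwards [hev, hσ.eventually hk] with s' h1 h2
  rw [h2, h1, hk.self_of_nhds]

variable {F} in
theorem snd_comp_eq_of_isTangent {φ} (hφ : φ ∈ F.atlas) {J : Set ℝ} (hJ : Convex ℝ J)
    {σ σ' : ℝ → Fin n → ℝ} (hmem : ∀ t ∈ J, σ t ∈ φ.source)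
    (hd : ∀ t ∈ J, HasDerivWithinAt σ (σ' t) J t) (ht : ∀ t ∈ J, F.IsTangent (σ t) (σ' t))
    {s t : ℝ} (hs : s ∈ J) (ht' : t ∈ J) : (φ (σ t)).2 = (φ (σ s)).2 := by
  have h : ∀ t ∈ J, HasDerivWithinAt (fun t => (φ (σ t)).2) 0 J t := by
    intro t htJ
    have := (hasFDerivAt_chart_snd hφ (hmem t htJ)).comp_hasDerivWithinAt t (hd t htJ)
    exact this.congr_deriv ((ht t htJ).snd_fderiv_eq_zero hφ (hmem t htJ))
  have := hJ.norm_image_sub_le_of_norm_hasDerivWithin_le h (C := 0) (by simp) hs ht'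
  simpa [sub_eq_zero] using this

theorem isLeafwiseAt_of_isTangent {I : Set ℝ} (hI : Convex ℝ I) {σ σ' : ℝ → Fin n → ℝ}
    (hU : ∀ t ∈ I, σ t ∈ U) (hd : ∀ t ∈ I, HasDerivWithinAt σ (σ' t) I t)
    (ht : ∀ t ∈ I, F.IsTangent (σ t) (σ' t)) {s : ℝ} (hs : s ∈ I) : F.IsLeafwiseAt I σ s := by
  obtain ⟨φ, hφ, hsφ⟩ := F.exists_chart (σ s) (hU s hs)
  refine ⟨φ, hφ, hsφ, ?_⟩
  obtain ⟨ε, hε, hb⟩ := Metric.mem_nhdsWithin_iff.1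
    ((hd s hs).continuousWithinAt.preimage_mem_nhdsWithin (φ.open_source.mem_nhds hsφ))
  filter_upwards [inter_mem_nhdsWithin I (ball_mem_nhds s hε)] with s' hs'
  refine snd_comp_eq_of_isTangent hφ (J := I ∩ ball s ε) (hI.inter (convex_ball s ε))
    (fun t ht => hb ⟨ht.2, ht.1⟩) (fun t ht => (hd t ht.1).mono inter_subset_left)
    (fun t h => ht t h.1) ⟨hs, mem_ball_self hε⟩ hs'

/-- Moving a leafwise curve along curves tangent to the foliation yields leafwise curves. -/
theorem isLeafwiseAt_transport {I J : Set ℝ} (hJ : Convex ℝ J) {x x' : ℝ → ℝ → Fin n → ℝ}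
    (hU : ∀ t ∈ J, ∀ s ∈ I, x t s ∈ U)
    (hc : ContinuousOn (fun z : ℝ × ℝ => x z.1 z.2) (J ×ˢ I))
    (hd : ∀ t ∈ J, ∀ s ∈ I, HasDerivWithinAt (fun t => x t s) (x' t s) J t)
    (ht : ∀ t ∈ J, ∀ s ∈ I, F.IsTangent (x t s) (x' t s)) {t₀ t₁ s : ℝ} (ht₀ : t₀ ∈ J)
    (ht₁ : t₁ ∈ J) (hs : s ∈ I) (h : F.IsLeafwiseAt I (x t₀) s) :
    F.IsLeafwiseAt I (x t₁) s := by
  have hcs : ∀ t ∈ J, ContinuousWithinAt (x t) I s := fun t htJ =>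
    (hc (t, s) ⟨htJ, hs⟩).comp (f := fun s => (t, s)) (by fun_prop) fun s' hs' => ⟨htJ, hs'⟩
  -- By connectedness of `J` it suffices that the property is locally constant in `t`. Near `(t, s)`
  -- everything lies in one chart, whose second component does not change along the tangent curves,
  -- so the times `t` and `t'` give the same function of `s'`.
  refine (hJ.isPreconnected.induction₂
    (fun t t' => F.IsLeafwiseAt I (x t) s ↔ F.IsLeafwiseAt I (x t') s) (fun t htJ => ?_)
    (fun _ _ _ _ _ _ h1 h2 => h1.trans h2) (fun _ _ _ _ h => h.symm) ht₀ ht₁).1 h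
  obtain ⟨φ, hφ, hsφ⟩ := F.exists_chart (x t s) (hU t htJ s hs)
  obtain ⟨ε, hε, hb⟩ := Metric.mem_nhdsWithin_iff.1
    ((hc (t, s) ⟨htJ, hs⟩).preimage_mem_nhdsWithin (φ.open_source.mem_nhds hsφ))
  have hb' : ∀ t' ∈ J ∩ ball t ε, ∀ s' ∈ I ∩ ball s ε, x t' s' ∈ φ.source := by
    intro t' ht' s' hs'
    have : (t', s') ∈ ball (t, s) ε ∩ J ×ˢ I := by
      rw [← ball_prod_same]
      exact ⟨⟨ht'.2, hs'.2⟩, ht'.1, hs'.1⟩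
    exact hb this
  have htt : t ∈ J ∩ ball t ε := ⟨htJ, mem_ball_self hε⟩
  have hss : s ∈ I ∩ ball s ε := ⟨hs, mem_ball_self hε⟩
  filter_upwards [inter_mem_nhdsWithin J (ball_mem_nhds t hε)] with t' ht'
  have key : ∀ s' ∈ I ∩ ball s ε, (φ (x t' s')).2 = (φ (x t s')).2 := fun s' hs' =>
    snd_comp_eq_of_isTangent hφ (σ := fun t => x t s') (σ' := fun t => x' t s')
      (hJ.inter (convex_ball t ε)) (fun τ hτ => hb' τ hτ s' hs')
      (fun τ hτ => (hd τ hτ.1 s' hs'.1).mono inter_subset_left)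
      (fun τ hτ => ht τ hτ.1 s' hs'.1) htt ht'
  constructor
  · intro hl
    refine ⟨φ, hφ, hb' t' ht' s hss, ?_⟩
    filter_upwards [hl.eventually_snd_eq (hcs t htJ) hφ hsφ,
      inter_mem_nhdsWithin I (ball_mem_nhds s hε)] with s' h1 h2
    rw [key s' h2, key s hss, h1]
  · intro hl
    refine ⟨φ, hφ, hsφ, ?_⟩
    filter_upwards [hl.eventually_snd_eq (hcs t' ht'.1) hφ (hb' t' ht' s hss),
      inter_mem_nhdsWithin I (ball_mem_nhds s hε)] with s' h1 h2
    rw [← key s' h2, ← key s hss, h1]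

/-- A leafwise curve of the form `s' ↦ σ s + (s' - s) • w + (u s' - u s) • e`, where `e` is transverse
and `w - a • e` is tangent to the foliation at `σ s`, satisfies `u' s = -a`. -/
theorem hasDerivWithinAt_of_isLeafwiseAt {I : Set ℝ} {σ : ℝ → Fin n → ℝ} {s a : ℝ}
    {u : ℝ → ℝ} {e w : Fin n → ℝ} (hσ : ContinuousWithinAt σ I s) (h : F.IsLeafwiseAt I σ s)
    (heq : ∀ s' ∈ I, σ s' - σ s = (s' - s) • w + (u s' - u s) • e)
    (he : ¬ F.IsTangent (σ s) e) (ht : F.IsTangent (σ s) (w - a • e)) :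
    HasDerivWithinAt u (-a) I s := by
  obtain ⟨φ, hφ, hsφ, hev⟩ := h
  rw [F.isTangent_iff hφ hsφ] at he ht
  obtain ⟨i, hi⟩ : ∃ i, (fderiv ℝ φ (σ s) e).2 i ≠ 0 := by
    by_contra! hcon
    exact he (funext hcon)
  have hD : HasFDerivAt (fun y => (φ y).2 i)
      ((ContinuousLinearMap.proj (R := ℝ) (φ := fun _ : Fin q => ℝ) i).comp
        ((ContinuousLinearMap.snd ℝ _ _).comp (fderiv ℝ φ (σ s)))) (σ s) :=
    hasFDerivAt_pi'.1 (hasFDerivAt_chart_snd hφ hsφ) i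
  have hw : (fderiv ℝ φ (σ s) w).2 i = a * (fderiv ℝ φ (σ s) e).2 i := by
    have := congrFun ht i
    simpa [sub_eq_zero] using this
  set d := (fderiv ℝ φ (σ s) e).2 i with hd
  set g : ℝ → ℝ := fun s' => u s' - u s - (s' - s) • (-a) with hg
  set Δ : ℝ → Fin n → ℝ := fun s' => σ s' - σ s with hΔ
  -- The `i`-th transverse coordinate is constant along `σ` and its differential sends `Δ` to `d *
  -- g`, so `g = o(Δ)`.
  have h1 := hD.isLittleO.comp_tendsto hσ
  have h2 : g =o[𝓝[I] s] Δ := by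
    have h3 := h1.const_mul_left (-d⁻¹)
    refine h3.congr' ?_ EventuallyEq.rfl
    filter_upwards [hev, self_mem_nhdsWithin] with s' hs' hsI
    simp only [Function.comp_apply, hs', heq s' hsI, sub_self, map_add, map_smul,
      ContinuousLinearMap.comp_apply, ContinuousLinearMap.proj_apply, smul_eq_mul, hg,
      ContinuousLinearMap.coe_snd', Prod.snd_add, Prod.smul_snd, Pi.add_apply, Pi.smul_apply, hw,
      ← hd]
    field_simp
    ring
  -- That `Δ = O(s' - s)` is not known beforehand. But `Δ - g • e` is exactly linear in `s' - s`,
  -- and the term `g • e = o(Δ)` can be absorbed.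
  have h4 : (fun s' => g s' • e) =o[𝓝[I] s] Δ := by
    refine Asymptotics.IsBigO.trans_isLittleO ?_ h2
    exact Asymptotics.IsBigO.of_bound ‖e‖ (Eventually.of_forall fun s' => by
      rw [norm_smul, mul_comm])
  have h5 : (fun s' => Δ s' - g s' • e) =O[𝓝[I] s] fun s' => s' - s := by
    refine Asymptotics.IsBigO.of_bound ‖w - a • e‖ ?_
    filter_upwards [self_mem_nhdsWithin] with s' hsI
    have : Δ s' - g s' • e = (s' - s) • (w - a • e) := by
      simp only [hΔ, heq s' hsI, hg, smul_eq_mul]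
      module
    rw [this, norm_smul, mul_comm]
  rw [hasDerivWithinAt_iff_isLittleO]
  exact h2.trans_isBigO (h4.right_isBigO_sub.trans h5)

end Foliation

end

/-! ### The quadrilateral argument. -/

namespace TwistedMetric

open BilinField Set Metric

variable {n : ℕ}

theorem coframe_zero_apply (hn : 3 ≤ n) (c : ℝ) (x v : Fin n → ℝ) :
    coframe hn c x ⟨0, by omega⟩ v =
      c * (v ⟨0, by omega⟩ + x ⟨2, by omega⟩ * v ⟨1, by omega⟩) := by
  simp [coframe]
  ring

theorem metric_apply_of_eq_zero (hn : 3 ≤ n) (c : ℝ) (x v : Fin n → ℝ)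
    (hv : ∀ i : Fin n, 3 ≤ (i : ℕ) → v i = 0) :
    metric hn c x v v =
      -(c * (v ⟨0, by omega⟩ + x ⟨2, by omega⟩ * v ⟨1, by omega⟩)) ^ 2 +
        v ⟨1, by omega⟩ ^ 2 + v ⟨2, by omega⟩ ^ 2 := by
  rw [metric_eq_diagForm, diagForm_apply, sum_eq_three hn]
  · rw [coframe_zero_apply]
    simp [coframe, sign]
    ring
  · intro i hi
    have : (i : ℕ) ≠ 0 := by omega
    simp [coframe, this, hv i hi]

theorem isTimelike_coordVec_zero (hn : 3 ≤ n) {c : ℝ} (hc : 0 < c) (x : Fin n → ℝ) :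
    IsTimelike (metric hn c) x (coordVec ⟨0, by omega⟩) := by
  rw [IsTimelike, metric_apply_of_eq_zero]
  · simp [coordVec]
    positivity
  · intro i hi
    have : (i : ℕ) ≠ 0 := by omega
    simp [coordVec, Fin.ext_iff, this]

/-- On `∂ᵢ - a ∂₀` the metric takes the value `1 - c² (a - m)²`, where `m` is the coefficient that
puts the vector into the span of `e₁, e₂`. -/
theorem abs_le_of_not_isTimelike (hn : 3 ≤ n) {c : ℝ} (hc : 0 < c) (x : Fin n → ℝ) {i : Fin n}
    (hi : (i : ℕ) = 1 ∨ (i : ℕ) = 2) {a : ℝ}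
    (h : ¬ IsTimelike (metric hn c) x (coordVec i - a • coordVec ⟨0, by omega⟩)) :
    |a - (if (i : ℕ) = 1 then x ⟨2, by omega⟩ else 0)| ≤ 1 / c := by
  have h1 : (c * (a - (if (i : ℕ) = 1 then x ⟨2, by omega⟩ else 0))) ^ 2 ≤ 1 ^ 2 := by
    rw [IsTimelike, not_lt, metric_apply_of_eq_zero] at h
    · obtain ⟨i, hi'⟩ := i
      rcases hi with rfl | rfl <;>
        simp [coordVec, -sq_le_one_iff_abs_le_one] at h ⊢ <;> nlinarith
    · intro j hj
      have h0 : (j : ℕ) ≠ 0 := by omega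
      have h1 : (j : ℕ) ≠ i := by omega
      simp [coordVec, Fin.ext_iff, h0, h1]
  have h2 := abs_le_of_sq_le_sq h1 zero_le_one
  rw [abs_mul, abs_of_pos hc] at h2
  rwa [le_div_iff₀ hc, mul_comm]

theorem norm_coordVec_sub_smul_le (i j : Fin n) (a : ℝ) :
    ‖coordVec i - a • coordVec j‖ ≤ 1 + |a| := by
  have h : ∀ i : Fin n, ‖coordVec i‖ = 1 := fun i => by simp [coordVec, Pi.norm_single]
  calc ‖coordVec i - a • coordVec j‖ ≤ ‖coordVec i‖ + ‖a • coordVec j‖ := norm_sub_le _ _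
    _ = 1 + |a| := by rw [norm_smul, h, h, mul_one, Real.norm_eq_abs]

theorem hasDerivWithinAt_coord {I : Set ℝ} {γ : ℝ → Fin n → ℝ} {v : Fin n → ℝ} {t : ℝ}
    (h : HasDerivWithinAt γ v I t) (i : Fin n) : HasDerivWithinAt (fun t => γ t i) (v i) I t :=
  hasDerivWithinAt_pi.1 h i

/-- The coordinates other than the one of `j` of an integral curve of `∂ᵢ - a ∂ⱼ`. -/
theorem apply_eq_of_hasDerivWithinAt {γ : ℝ → Fin n → ℝ} {a : ℝ → ℝ} {T : ℝ} {i j : Fin n}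
    (h : ∀ t ∈ Icc 0 T, HasDerivWithinAt γ (coordVec i - a t • coordVec j) (Icc 0 T) t)
    {k : Fin n} (hk : k ≠ j) {t : ℝ} (ht : t ∈ Icc 0 T) :
    γ t k = γ 0 k + t * coordVec i k := by
  have := abs_sub_sub_mul_le_of_hasDerivWithinAt (m := coordVec i k) (ε := 0)
    (fun t ht => hasDerivWithinAt_coord (h t ht) k)
    (fun t _ => by simp [coordVec, Pi.single_apply, hk]) ht
  rw [zero_mul, abs_nonpos_iff] at this
  linarith

/-- The change of the coordinate of `j` along an integral curve of `∂ᵢ - a ∂ⱼ`. -/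
theorem abs_apply_sub_le_of_hasDerivWithinAt {γ : ℝ → Fin n → ℝ} {a : ℝ → ℝ} {T m ε : ℝ}
    {i j : Fin n} (hij : i ≠ j)
    (h : ∀ t ∈ Icc 0 T, HasDerivWithinAt γ (coordVec i - a t • coordVec j) (Icc 0 T) t)
    (ha : ∀ t ∈ Icc 0 T, |a t - m| ≤ ε) {t : ℝ} (ht : t ∈ Icc 0 T) :
    |γ t j - γ 0 j + t * m| ≤ ε * t := by
  have := abs_sub_sub_mul_le_of_hasDerivWithinAt (m := -m) (ε := ε)
    (fun t ht => hasDerivWithinAt_coord (h t ht) j)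
    (fun t ht => by
      have : -a t - -m = -(a t - m) := by ring
      simpa [coordVec, Pi.single_apply, hij.symm, this, abs_sub_comm] using ha t ht) ht
  rwa [mul_neg, sub_neg_eq_add] at this

/-- The quadrilateral argument: a foliation without timelike tangent vectors cannot exist on a ball
that is large in comparison with `1 / c`. -/
theorem length_mul_le_of_not_isTimelike (hn : 3 ≤ n) {c : ℝ} (hc : 1 ≤ c) {U : Set (Fin n → ℝ)}
    (F : Foliation n 1 U)
    (hF : ∀ x ∈ U, ∀ v, F.IsTangent x v → ¬ IsTimelike (metric hn c) x v)
    {p : Fin n → ℝ} {R r : ℝ} (hR : 0 < R) (hr : 0 < r) (hp : closedBall p R ⊆ U)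
    (hrR : (2 + |p ⟨2, by omega⟩| + R) * r ≤ R / 2) : r * c ≤ 4 := by
  have hc0 : 0 < c := one_pos.trans_le hc
  have hc1 : 1 / c ≤ 1 := by rw [div_le_one hc0]; exact hc
  set i₀ : Fin n := ⟨0, by omega⟩ with hi₀
  set i₁ : Fin n := ⟨1, by omega⟩ with hi₁
  set i₂ : Fin n := ⟨2, by omega⟩ with hi₂
  have h10 : i₁ ≠ i₀ := by simp [hi₁, hi₀]
  have h20 : i₂ ≠ i₀ := by simp [hi₂, hi₀]
  have h21 : i₂ ≠ i₁ := by simp [hi₂, hi₁]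
  have he : ∀ x ∈ U, ¬ F.IsTangent x (coordVec i₀) := fun x hx h =>
    hF x hx _ h (isTimelike_coordVec_zero hn hc0 x)
  obtain ⟨a, ha, hta⟩ := F.exists_contDiffOn_isTangent_sub_smul he (coordVec i₁)
  obtain ⟨b, hb, htb⟩ := F.exists_contDiffOn_isTangent_sub_smul he (coordVec i₂)
  have ha' : ∀ x ∈ U, |a x - x i₂| ≤ 1 / c := fun x hx => by
    simpa [hi₁] using abs_le_of_not_isTimelike hn hc0 x (i := i₁) (Or.inl rfl) (hF x hx _ (hta x hx))
  have hb' : ∀ x ∈ U, |b x| ≤ 1 / c := fun x hx => by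
    simpa [hi₂] using abs_le_of_not_isTimelike hn hc0 x (i := i₂) (Or.inr rfl) (hF x hx _ (htb x hx))
  have hsub : closedBall p (R / 2) ⊆ closedBall p R := closedBall_subset_closedBall (by linarith)
  have hlip : ∀ (f : (Fin n → ℝ) → ℝ) (i : Fin n), ContDiffOn ℝ 1 f U → ∀ ρ ≤ R,
      ∃ K, LipschitzOnWith K (fun x => coordVec i - f x • coordVec i₀) (closedBall p ρ) :=
    fun f i hf ρ hρ => ContDiffOn.exists_lipschitzOnWith (n := 1)
      (contDiffOn_const.sub ((hf.mono ((closedBall_subset_closedBall hρ).trans hp)).smul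
        contDiffOn_const)) one_ne_zero (convex_closedBall p ρ) (isCompact_closedBall p ρ)
  obtain ⟨Ka, hKa⟩ := hlip a i₁ ha R le_rfl
  obtain ⟨Kb, hKb⟩ := hlip b i₂ hb (R / 2) (by linarith)
  -- A common bound for the speeds of both fields: `1 + |a|` with `|a| ≤ 1/c + R + |p i₂|` and `1/c
  -- ≤ 1`.
  have hL : 0 ≤ 2 + |p i₂| + R := by positivity
  have hna : ∀ x ∈ closedBall p R, ‖coordVec i₁ - a x • coordVec i₀‖ ≤ 2 + |p i₂| + R := by
    intro x hx
    refine (norm_coordVec_sub_smul_le _ _ _).trans ?_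
    have h1 := ha' x (hp hx)
    have h2 : |x i₂ - p i₂| ≤ R := by
      rw [← Real.dist_eq]; exact (dist_le_pi_dist x p i₂).trans hx
    have h3 : |a x| ≤ |a x - x i₂| + |x i₂ - p i₂| + |p i₂| := by
      have := abs_add_three (a x - x i₂) (x i₂ - p i₂) (p i₂)
      simpa using this
    linarith
  have hnb : ∀ x ∈ closedBall p (R / 2), ‖coordVec i₂ - b x • coordVec i₀‖ ≤
      2 + |p i₂| + R := by
    intro x hx
    refine (norm_coordVec_sub_smul_le _ _ _).trans ?_
    have h1 := hb' x (hp (hsub hx))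
    have h2 := abs_nonneg (p i₂)
    linarith
  -- Each of the two legs uses up half of the radius: `β` starts at `p` and stays in the ball of
  -- radius `R / 2`; `α` starts in that ball and stays in the ball of radius `R`.
  obtain ⟨β, hβ, hβc⟩ := exists_continuousOn_flow (x₀ := p) (a := ⟨R / 2, by positivity⟩) (r := 0)
    (L := ⟨_, hL⟩) hr.le hnb hKb
    (by change (2 + |p i₂| + R) * r ≤ R / 2 - 0; simpa using hrR)
  obtain ⟨α, hα, hαc⟩ := exists_continuousOn_flow (x₀ := p) (a := ⟨R, hR.le⟩)
    (r := ⟨R / 2, by positivity⟩) (L := ⟨_, hL⟩) hr.le hna hKa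
    (by change (2 + |p i₂| + R) * r ≤ R - R / 2; linarith)
  obtain ⟨hβ0, hβ⟩ := hβ p (by simp)
  set σ : ℝ → Fin n → ℝ := β p with hσ
  change ∀ t ∈ Icc 0 r, σ t ∈ closedBall p (R / 2) ∧ _ at hβ
  change ∀ x ∈ closedBall p (R / 2), α x 0 = x ∧ ∀ t ∈ Icc 0 r, α x t ∈ closedBall p R ∧ _ at hα
  change ContinuousOn _ (closedBall p (R / 2) ×ˢ Icc 0 r) at hαc
  have hx0 : ∀ s ∈ Icc 0 r, α (σ s) 0 = σ s := fun s hs => (hα _ (hβ s hs).1).1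
  have hxU : ∀ t ∈ Icc 0 r, ∀ s ∈ Icc 0 r, α (σ s) t ∈ U := fun t ht s hs =>
    hp ((hα _ (hβ s hs).1).2 t ht).1
  have hxd : ∀ t ∈ Icc 0 r, ∀ s ∈ Icc 0 r, HasDerivWithinAt (fun t => α (σ s) t)
      (coordVec i₁ - a (α (σ s) t) • coordVec i₀) (Icc 0 r) t := fun t ht s hs =>
    ((hα _ (hβ s hs).1).2 t ht).2
  have hσd : ∀ s ∈ Icc 0 r, HasDerivWithinAt σ (coordVec i₂ - b (σ s) • coordVec i₀)
      (Icc 0 r) s := fun s hs => (hβ s hs).2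
  have hσU : ∀ s ∈ Icc 0 r, σ s ∈ U := fun s hs => hp (hsub (hβ s hs).1)
  have hσc : ContinuousOn σ (Icc 0 r) := HasDerivWithinAt.continuousOn hσd
  have hxc : ContinuousOn (fun z : ℝ × ℝ => α (σ z.2) z.1) (Icc 0 r ×ˢ Icc 0 r) :=
    hαc.comp (f := fun z : ℝ × ℝ => (σ z.2, z.1))
      ((hσc.comp continuousOn_snd fun z hz => hz.2).prodMk continuousOn_fst)
      fun z hz => ⟨(hβ z.2 hz.2).1, hz.1⟩
  have hσk : ∀ s ∈ Icc 0 r, ∀ k ≠ i₀, σ s k = p k + s * coordVec i₂ k := fun s hs k hk => by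
    rw [apply_eq_of_hasDerivWithinAt hσd hk hs, hβ0]
  have hxk : ∀ t ∈ Icc 0 r, ∀ s ∈ Icc 0 r, ∀ k ≠ i₀,
      α (σ s) t k = p k + s * coordVec i₂ k + t * coordVec i₁ k := fun t ht s hs k hk => by
    rw [apply_eq_of_hasDerivWithinAt (fun t ht => hxd t ht s hs) hk ht, hx0 s hs, hσk s hs k hk]
  have h0r : (0 : ℝ) ∈ Icc 0 r := ⟨le_rfl, hr.le⟩
  have hrr : r ∈ Icc 0 r := ⟨hr.le, le_rfl⟩
  -- Along the side over `s` the coordinate `x₂` is constantly `p i₂ + s`, so `x₀` changes by `-r (p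
  -- i₂ + s)` up to `r / c`.
  have hside : ∀ s ∈ Icc 0 r,
      |α (σ s) r i₀ - σ s i₀ + r * (p i₂ + s)| ≤ 1 / c * r := fun s hs => by
    have := abs_apply_sub_le_of_hasDerivWithinAt (m := p i₂ + s) (ε := 1 / c) h10
      (fun t ht => hxd t ht s hs) (fun t ht => by
        have h1 := ha' _ (hxU t ht s hs)
        rw [hxk t ht s hs i₂ h20] at h1
        simpa [coordVec, Pi.single_apply, h21] using h1) hrr
    rwa [hx0 s hs] at this
  have hbottom : |σ r i₀ - σ 0 i₀| ≤ 1 / c * r := by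
    simpa using abs_apply_sub_le_of_hasDerivWithinAt (m := 0) h20 hσd
      (fun s hs => by simpa using hb' _ (hσU s hs)) hrr
  -- The flow is known only to be continuous in its initial point. The derivative of the top side
  -- comes from its lying in a leaf and from its other coordinates being known explicitly.
  have htd : ∀ s ∈ Icc 0 r, HasDerivWithinAt (fun s => α (σ s) r i₀) (-b (α (σ s) r))
      (Icc 0 r) s := by
    intro s hs
    have hleaf : F.IsLeafwiseAt (Icc 0 r) (fun s => α (σ s) r) s := by
      refine F.isLeafwiseAt_transport (convex_Icc 0 r) (x := fun t s => α (σ s) t) hxU hxc hxd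
        (fun t ht s hs => hta _ (hxU t ht s hs)) h0r hrr hs ?_
      refine F.isLeafwiseAt_of_isTangent (convex_Icc 0 r)
        (σ' := fun s => coordVec i₂ - b (σ s) • coordVec i₀) (fun s hs => ?_) (fun s hs => ?_)
        (fun s hs => ?_) hs
      · exact hxU 0 h0r s hs
      · exact (hσd s hs).congr_of_mem hx0 hs
      · simpa only [hx0 s hs] using htb _ (hσU s hs)
    refine F.hasDerivWithinAt_of_isLeafwiseAt (e := coordVec i₀) (w := coordVec i₂) ?_ hleaf ?_
      (he _ (hxU r hrr s hs)) (htb _ (hxU r hrr s hs))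
    · exact (hxc (r, s) ⟨hrr, hs⟩).comp (f := fun s => (r, s)) (by fun_prop)
        fun s' hs' => ⟨hrr, hs'⟩
    · intro s' hs'
      ext k
      by_cases hk : k = i₀
      · subst hk
        simp [coordVec, h20.symm]
      · simp only [Pi.sub_apply, Pi.add_apply, Pi.smul_apply, smul_eq_mul,
          hxk r hrr s hs k hk, hxk r hrr s' hs' k hk]
        simp only [coordVec, Pi.single_apply, hk, if_false]
        ring
  have htop : |α (σ r) r i₀ - α (σ 0) r i₀| ≤ 1 / c * r := by
    simpa using abs_sub_sub_mul_le_of_hasDerivWithinAt (m := 0) htd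
      (fun s hs => by simpa using hb' _ (hxU r hrr s hs)) hrr
  have h1 := abs_le.1 (hside 0 h0r)
  have h2 := abs_le.1 (hside r hrr)
  have h3 := abs_le.1 hbottom
  have h4 := abs_le.1 htop
  -- The main terms of the sides over `0` and `r` differ by `r²`; the errors of the four sides add
  -- up to at most `4r/c`.
  have h5 : r * r ≤ 4 * (1 / c * r) := by nlinarith
  have h6 : r ≤ 4 * (1 / c) := le_of_mul_le_mul_right (by linarith) hr
  calc r * c ≤ 4 * (1 / c) * c := by gcongr
    _ = 4 := by field_simp

end TwistedMetric

end

/-! ### Choice of `c₀` and conclusion. -/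

theorem theorem0p4 (n : ℕ) (hn : 3 ≤ n) (Λ : ℝ) (U : Set (Fin n → ℝ)) (hU : IsOpen U)
    (hUne : U.Nonempty) :
    ∃ c₀ : ℝ, 0 < c₀ ∧ ∀ c : ℝ, c₀ ≤ c →
      (¬ ∃ F : Foliation n 1 U, ∀ x ∈ U, ∀ v, F.IsTangent x v →
        ¬ BilinField.IsTimelike (TwistedMetric.metric hn c) x v) ∧
      (¬ ∃ F : Foliation n 1 U, F.IsSpacelike (TwistedMetric.metric hn c)) ∧
      BilinField.DominantEnergyCondition (TwistedMetric.metric hn c) Λ := by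
  obtain ⟨p, hp⟩ := hUne
  obtain ⟨R, hR, hball⟩ := Metric.nhds_basis_closedBall.mem_iff.1 (hU.mem_nhds hp)
  have hL : 0 < 2 + |p ⟨2, by omega⟩| + R := by positivity
  set L := 2 + |p ⟨2, by omega⟩| + R
  set r := R / 2 / L with hr
  have hr0 : 0 < r := by positivity
  -- The three summands provide `1 ≤ c`, then `r * c ≥ 5 > 4`, and, since `c ≥ 1`, also `4 * |Λ| ≤ c
  -- ≤ c ^ 2`.
  refine ⟨1 + 5 / r + 4 * |Λ|, by positivity, fun c hc => ?_⟩
  have h5 : 0 < 5 / r := by positivity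
  have hΛ := abs_nonneg Λ
  have hc1 : 1 ≤ c := by linarith
  have key : ¬ ∃ F : Foliation n 1 U, ∀ x ∈ U, ∀ v, F.IsTangent x v →
      ¬ BilinField.IsTimelike (TwistedMetric.metric hn c) x v := by
    rintro ⟨F, hF⟩
    have h1 := TwistedMetric.length_mul_le_of_not_isTimelike hn hc1 F hF hR hr0 hball
      (by rw [hr, mul_div_cancel₀ _ hL.ne'])
    have h2 : 5 / r ≤ c := by linarith
    rw [div_le_iff₀ hr0] at h2
    linarith
  refine ⟨key, ?_, ?_⟩
  · rintro ⟨F, hF⟩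
    refine key ⟨F, fun x hx v hv hT => ?_⟩
    rcases eq_or_ne v 0 with rfl | hv0
    · simp [BilinField.IsTimelike] at hT
    · exact lt_asymm (hF x hx v hv hv0) hT
  · exact TwistedMetric.dominantEnergyCondition_metric hn (by positivity) (by nlinarith)
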